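/- Let $\Gamma$ be a finitely generated group and let $\mathcal G$ be the right Cayley graph of $\Gamma$ with respect to a finite generating set $S$: the vertices are the elements of $\Gamma$, and distinct $g,h\in\Gamma$ are adjacent if and only if $g^{-1}h\in S\cup S^{-1}$. Let $d$ denote the graph distance of $\mathcal G$ and $o$ the identity of $\Gamma$. A $\Gamma$-invariant site percolation on $\mathcal G$ is a probability measure $\mathbb P$ on the subsets $\omega\subseteq\Gamma$ (with the product $\sigma$-algebra of $\{0,1\}^\Gamma$) which is invariant under left translation by elements of $\Gamma$. Its two-point function is $\tau(g,h)=\mathbb P[g\leftrightarrow h]$, the probability that $g$ and $h$ both belong to $\omega$ and lie in the same connected component of the subgraph of $\mathcal G$ induced by $\omega$. Then $\Gamma$ has the Haagerup property (that is, it admits a metrically proper affine isometric action on a Hilbert space) if and only if for every $\alpha<1$ there exists a $\Gamma$-invariant site percolation $\mathbb P$ on $\mathcal G$ such that $\mathbb P[o\in\omega]>\alpha$ and $$\lim_{r\to\infty}\ \sup_{g,h\in\Gamma,\ d(g,h)>r}\tau(g,h)=0$$ (the supremum over the empty set being $0$). -/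

import Mathlib

open MeasureTheory
open scoped Pointwise

universe u

/-- A (discrete) group has the Haagerup property if it admits an affine isometric action on a
Hilbert space which is metrically proper: for every bounded set `B`, only finitely many group
elements `g` satisfy `gB ∩ B ≠ ∅`. (Continuity of the action is automatic for discrete groups;
a complex Hilbert space is in particular a real one.) -/
def HasHaagerupProperty (Γ : Type u) [Group Γ] : Prop :=
  ∃ (H : Type u) (_ : NormedAddCommGroup H) (_ : InnerProductSpace ℝ H) (_ : CompleteSpace H)
    (ρ : Γ →* (H ≃ᵃⁱ[ℝ] H)),
    ∀ B : Set H, Bornology.IsBounded B → {g : Γ | ((ρ g '' B) ∩ B).Nonempty}.Finite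

/-- A `Γ`-invariant site percolation on a graph with vertex set `Γ`: a probability measure on the
subsets of `Γ` (with the product `σ`-algebra of `{0,1}^Γ`) which is invariant under left
translation. -/
structure IsInvariantSitePercolation {Γ : Type u} [Group Γ] (P : Measure (Set Γ)) : Prop where
  isProbabilityMeasure : IsProbabilityMeasure P
  map_smul : ∀ γ : Γ, P.map (fun ω : Set Γ => γ • ω) = P

/-- Left translation of configurations is measurable, so the push-forward above is genuine. -/
theorem measurable_smul_configuration {Γ : Type u} [Group Γ] (γ : Γ) :
    Measurable (fun ω : Set Γ => γ • ω) := by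
  rw [measurable_set_iff]
  intro a
  simp only [Set.mem_smul_set_iff_inv_smul_mem]
  exact measurable_set_mem _

/-- `g` and `h` are in the same cluster of the site configuration `ω`: both are vertices of the
subgraph of `G` induced by `ω`, and they lie in the same connected component of it. -/
def SameCluster {V : Type u} (G : SimpleGraph V) (ω : Set V) (g h : V) : Prop :=
  ∃ (hg : g ∈ ω) (hh : h ∈ ω), (G.induce ω).Reachable ⟨g, hg⟩ ⟨h, hh⟩

/-- The two-point function `τ(g,h) = P[g ↔ h]` of a site percolation `P` on `G`. -/
noncomputable def twoPointFunction {V : Type u} (G : SimpleGraph V) (P : Measure (Set V))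
    (g h : V) : ℝ :=
  P.real {ω : Set V | SameCluster G ω g h}

/-- The supremum of `τ(g,h)` over all `g,h` at graph distance more than `r` tends to `0` as
`r → ∞`. -/
def VanishesAtInfinity {V : Type u} (G : SimpleGraph V) (τ : V → V → ℝ) : Prop :=
  ∀ ε : ℝ, 0 < ε → ∃ r : ℕ, ∀ g h : V, r < G.dist g h → |τ g h| ≤ ε

/-! Both directions pass between percolations and Hilbert space geometry. From percolation to
Haagerup: the event that two sites share a cluster is a partial equivalence relation, so its
indicator, and hence the two-point function `τ`, is positive definite. Taking percolations with
densities tending to `1` exponentially fast, the kernel `∑ (τ n g h - 1)` converges, is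
left-invariant and conditionally positive definite, and drops to `-∞` far from the diagonal because
each `τ n` vanishes at infinity. By a GNS-type construction (`hasHaagerupProperty_of_kernel`) it
gives a proper affine isometric action. From Haagerup to percolation: the orbit map `b g = g • 0` of
a proper action is a cocycle. The centered Gaussian field `X` with covariance `⟪b g, b h⟫` has
stationary increments, with `X g - X h` of variance `‖b g - b h‖ ^ 2`. Cut `ℝ` into unit intervals
with a uniformly random offset and keep the sites whose value lies in the same cell as those of
their neighbours `g * s`. Clusters stay in one cell, so `τ(g,h)` is at most the probability that `|X
g - X h| ≤ 1`, which is small when the variance is large; scaling `b` down makes the density close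
to `1`. -/

/-! ### Affine isometric actions from conditionally positive definite kernels -/

/-- A metrically proper isometric action on a real semi-inner product space extends to the
completion, and so yields the Haagerup property. -/
theorem hasHaagerupProperty_of_isometric_action {Γ V : Type u} [Group Γ]
    [SeminormedAddCommGroup V] [InnerProductSpace ℝ V] (A : Γ → V → V)
    (hA : ∀ g, Isometry (A g)) (hone : A 1 = id) (hmul : ∀ g h, A (g * h) = A g ∘ A h)
    (hproper : ∀ M : ℝ, {g : Γ | ‖A g 0‖ ≤ M}.Finite) :
    HasHaagerupProperty Γ := by
  classical
  let F : Γ → UniformSpace.Completion V → UniformSpace.Completion V :=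
    fun g => UniformSpace.Completion.map (A g)
  have hFone : F 1 = id := by simp [F, hone]
  have hFmul : ∀ g h, F (g * h) = F g ∘ F h := fun g h => by
    simp only [F, hmul]
    exact (UniformSpace.Completion.map_comp (hA g).uniformContinuous (hA h).uniformContinuous).symm
  have hFiso : ∀ g, Isometry (F g) := fun g => (hA g).completion_map
  let E : Γ → (UniformSpace.Completion V ≃ᵢ UniformSpace.Completion V) := fun g =>
    { toFun := F g
      invFun := F g⁻¹
      left_inv := fun x => by
        have := congrFun (hFmul g⁻¹ g) x
        rw [inv_mul_cancel, hFone] at this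
        exact this.symm
      right_inv := fun x => by
        have := congrFun (hFmul g g⁻¹) x
        rw [mul_inv_cancel, hFone] at this
        exact this.symm
      isometry_toFun := hFiso g }
  let ρ : Γ →* (UniformSpace.Completion V ≃ᵃⁱ[ℝ] UniformSpace.Completion V) :=
    { toFun := fun g => (E g).toRealAffineIsometryEquiv
      map_one' := by
        ext x
        change F 1 x = x
        rw [hFone]; rfl
      map_mul' := fun g h => by
        ext x
        change F (g * h) x = F g (F h x)
        rw [hFmul]; rfl }
  have hρ : ∀ g x, ρ g x = F g x := fun g x => rfl
  refine ⟨UniformSpace.Completion V, inferInstance, inferInstance, inferInstance, ρ, fun B hB => ?_⟩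
  obtain ⟨R, hR⟩ := hB.subset_closedBall 0
  refine (hproper (R + R)).subset ?_
  rintro g ⟨_, ⟨x, hx, rfl⟩, hgx⟩
  have h1 : ‖x‖ ≤ R := by simpa using hR hx
  have h2 : ‖ρ g x‖ ≤ R := by simpa using hR hgx
  have h3 : F g ((0 : V) : UniformSpace.Completion V) = (A g 0 : V) :=
    UniformSpace.Completion.map_coe (hA g).uniformContinuous 0
  have h4 : ‖A g 0‖ = ‖F g 0‖ := by
    rw [← UniformSpace.Completion.norm_coe, ← h3]; rfl
  have h5 : dist (F g 0) (F g x) = dist 0 x := (hFiso g).dist_eq 0 x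
  rw [dist_eq_norm, dist_eq_norm, zero_sub, norm_neg] at h5
  change ‖A g 0‖ ≤ R + R
  rw [h4]
  have h6 := norm_add_le (F g 0 - F g x) (F g x)
  rw [sub_add_cancel, h5] at h6
  rw [hρ] at h2
  linarith

/-- The bilinear form on finitely supported functions attached to a kernel. -/
noncomputable def kernelForm {T : Type u} (κ : T → T → ℝ) : (T →₀ ℝ) →ₗ[ℝ] (T →₀ ℝ) →ₗ[ℝ] ℝ :=
  Finsupp.linearCombination ℝ fun g => Finsupp.linearCombination ℝ (κ g)

theorem kernelForm_single {T : Type u} (κ : T → T → ℝ) (g h : T) (a b : ℝ) :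
    kernelForm κ (Finsupp.single g a) (Finsupp.single h b) = a * (b * κ g h) := by
  simp [kernelForm, Finsupp.linearCombination_single]

theorem kernelForm_apply {T : Type u} (κ : T → T → ℝ) (x y : T →₀ ℝ) :
    kernelForm κ x y = ∑ g ∈ x.support, ∑ h ∈ y.support, x g * y h * κ g h := by
  simp [kernelForm, Finsupp.linearCombination_apply, Finsupp.sum, LinearMap.sum_apply,
    Finset.mul_sum, mul_assoc]

theorem kernelForm_comm {T : Type u} {κ : T → T → ℝ} (hκ : ∀ g h, κ g h = κ h g)
    (x y : T →₀ ℝ) : kernelForm κ x y = kernelForm κ y x := by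
  rw [kernelForm_apply, kernelForm_apply, Finset.sum_comm]
  refine Finset.sum_congr rfl fun g _ => Finset.sum_congr rfl fun h _ => ?_
  rw [hκ]; ring

/-- The sum of the values of a finitely supported function. -/
noncomputable def totalMass (T : Type u) : (T →₀ ℝ) →ₗ[ℝ] ℝ :=
  Finsupp.linearCombination ℝ fun _ => (1 : ℝ)

theorem totalMass_apply {T : Type u} (x : T →₀ ℝ) : totalMass T x = ∑ g ∈ x.support, x g := by
  simp [totalMass, Finsupp.linearCombination_apply, Finsupp.sum]

theorem totalMass_single {T : Type u} (g : T) (a : ℝ) :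
    totalMass T (Finsupp.single g a) = a := by
  simp [totalMass, Finsupp.linearCombination_single]

/-- Left translation of finitely supported functions. -/
noncomputable def leftTranslate {Γ : Type u} [Group Γ] (g : Γ) : (Γ →₀ ℝ) →ₗ[ℝ] (Γ →₀ ℝ) :=
  Finsupp.lmapDomain ℝ ℝ (g * ·)

theorem leftTranslate_single {Γ : Type u} [Group Γ] (g h : Γ) (a : ℝ) :
    leftTranslate g (Finsupp.single h a) = Finsupp.single (g * h) a := by
  simp [leftTranslate]

theorem totalMass_leftTranslate {Γ : Type u} [Group Γ] (g : Γ) (x : Γ →₀ ℝ) :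
    totalMass Γ (leftTranslate g x) = totalMass Γ x := by
  have : (totalMass Γ) ∘ₗ leftTranslate g = totalMass Γ := by
    ext h
    simp [leftTranslate_single, totalMass_single]
  exact LinearMap.congr_fun this x

theorem leftTranslate_one {Γ : Type u} [Group Γ] (x : Γ →₀ ℝ) : leftTranslate 1 x = x := by
  have : leftTranslate (1 : Γ) = LinearMap.id := by
    ext h : 2
    simp [leftTranslate_single]
  rw [this]; rfl

theorem leftTranslate_mul {Γ : Type u} [Group Γ] (g h : Γ) (x : Γ →₀ ℝ) :
    leftTranslate (g * h) x = leftTranslate g (leftTranslate h x) := by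
  have : leftTranslate (g * h) = leftTranslate g ∘ₗ leftTranslate h := by
    ext k : 2
    simp [leftTranslate_single, mul_assoc]
  rw [this]; rfl

theorem kernelForm_leftTranslate {Γ : Type u} [Group Γ] {κ : Γ → Γ → ℝ}
    (hκ : ∀ γ g h, κ (γ * g) (γ * h) = κ g h) (γ : Γ) (x y : Γ →₀ ℝ) :
    kernelForm κ (leftTranslate γ x) (leftTranslate γ y) = kernelForm κ x y := by
  have : (kernelForm κ).compl₁₂ (leftTranslate γ) (leftTranslate γ) = kernelForm κ := by
    ext g h
    simp [leftTranslate_single, kernelForm_single, hκ]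
  exact LinearMap.congr_fun₂ this x y

/-- Projection of finitely supported functions to those of total mass zero. -/
noncomputable def recenter (Γ : Type u) [Group Γ] : (Γ →₀ ℝ) →ₗ[ℝ] (Γ →₀ ℝ) :=
  LinearMap.id - (totalMass Γ).smulRight (Finsupp.single 1 1)

theorem recenter_apply {Γ : Type u} [Group Γ] (x : Γ →₀ ℝ) :
    recenter Γ x = x - totalMass Γ x • Finsupp.single 1 1 := by
  simp [recenter]

theorem totalMass_recenter {Γ : Type u} [Group Γ] (x : Γ →₀ ℝ) :
    totalMass Γ (recenter Γ x) = 0 := by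
  rw [recenter_apply, map_sub, map_smul, totalMass_single, smul_eq_mul, mul_one, sub_self]

/-- A left-invariant conditionally positive definite kernel with `κ 1 1 - κ 1 g` proper yields the
Haagerup property. -/
theorem hasHaagerupProperty_of_kernel {Γ : Type u} [Group Γ] (κ : Γ → Γ → ℝ)
    (hsymm : ∀ g h, κ g h = κ h g) (hinv : ∀ γ g h, κ (γ * g) (γ * h) = κ g h)
    (hpos : ∀ x : Γ →₀ ℝ, totalMass Γ x = 0 → 0 ≤ kernelForm κ x x)
    (hproper : ∀ M : ℝ, {g : Γ | κ 1 1 - κ 1 g ≤ M}.Finite) :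
    HasHaagerupProperty Γ := by
  let c : PreInnerProductSpace.Core ℝ (Γ →₀ ℝ) :=
    { inner := fun x y => kernelForm κ (recenter Γ x) (recenter Γ y)
      conj_inner_symm := fun x y => by
        simp only [conj_trivial]
        exact kernelForm_comm hsymm _ _
      re_inner_nonneg := fun x => by
        simpa using hpos _ (totalMass_recenter x)
      add_left := fun x y z => by simp
      smul_left := fun x y r => by simp }
  let _ : SeminormedAddCommGroup (Γ →₀ ℝ) :=
    @InnerProductSpace.Core.toSeminormedAddCommGroup ℝ _ _ _ _ c
  let _ : InnerProductSpace ℝ (Γ →₀ ℝ) := InnerProductSpace.ofCore c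
  have hinner : ∀ x : Γ →₀ ℝ, ‖x‖ ^ 2 = kernelForm κ (recenter Γ x) (recenter Γ x) := fun x => by
    rw [← real_inner_self_eq_norm_sq]; rfl
  -- On the mass-zero part `v = recenter Γ x` this is `v ↦ g v + δ_g - δ_1`, that is, left
  -- translation of the mass-one function `v + δ_1`. The origin is sent to `δ_g - δ_1`.
  let A : Γ → (Γ →₀ ℝ) → (Γ →₀ ℝ) := fun g x =>
    leftTranslate g x + (1 - totalMass Γ x) • (Finsupp.single g 1 - Finsupp.single 1 1)
  have hAmass : ∀ g x, totalMass Γ (A g x) = totalMass Γ x := fun g x => by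
    simp only [A, map_add, map_sub, map_smul, totalMass_leftTranslate, totalMass_single]
    simp
  refine hasHaagerupProperty_of_isometric_action A (fun g => ?_) ?_ (fun g h => ?_) (fun M => ?_)
  · refine Isometry.of_dist_eq fun x y => ?_
    rw [dist_eq_norm, dist_eq_norm]
    have hsq : ‖A g x - A g y‖ ^ 2 = ‖x - y‖ ^ 2 := by
      have h1 : recenter Γ (A g x - A g y) = leftTranslate g (recenter Γ (x - y)) := by
        rw [recenter_apply, recenter_apply, map_sub, hAmass, hAmass, map_sub, map_smul,
          leftTranslate_single, mul_one]
        simp only [A, map_sub]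
        module
      rw [hinner, hinner, h1, kernelForm_leftTranslate hinv]
    exact (sq_eq_sq₀ (norm_nonneg _) (norm_nonneg _)).1 hsq
  · funext x
    simp [A, leftTranslate_one]
  · funext x
    change A (g * h) x = A g (A h x)
    have h1 : A g (A h x) = leftTranslate g (A h x)
        + (1 - totalMass Γ x) • (Finsupp.single g 1 - Finsupp.single 1 1) := by
      rw [← hAmass h x]
    rw [h1]
    simp only [A, map_add, map_smul, map_sub, leftTranslate_mul, leftTranslate_single, mul_one]
    module
  · refine (hproper (M ^ 2 / 2)).subset fun g hg => ?_
    have h0 : recenter Γ (A g 0) = Finsupp.single g 1 - Finsupp.single 1 1 := by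
      rw [recenter_apply, hAmass]
      simp [A]
    have h1 : ‖A g 0‖ ^ 2 = 2 * (κ 1 1 - κ 1 g) := by
      have h2 : κ g g = κ 1 1 := by simpa using hinv g 1 1
      rw [hinner, h0]
      simp only [map_sub, LinearMap.sub_apply, kernelForm_single, h2, hsymm g 1]
      ring
    have h3 : ‖A g 0‖ ^ 2 ≤ M ^ 2 := pow_le_pow_left₀ (norm_nonneg _) hg 2
    change κ 1 1 - κ 1 g ≤ M ^ 2 / 2
    linarith

/-! ### Clusters and positivity of the two-point function -/

section Cluster

variable {V : Type u} {G : SimpleGraph V} {ω : Set V} {g h k : V}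

theorem sameCluster_iff_exists_walk :
    SameCluster G ω g h ↔ ∃ p : G.Walk g h, ∀ v ∈ p.support, v ∈ ω := by
  constructor
  · rintro ⟨hg, hh, ⟨p⟩⟩
    refine ⟨p.map (SimpleGraph.Embedding.induce ω).toHom, fun v hv => ?_⟩
    obtain ⟨w, -, rfl⟩ := List.mem_map.1 (SimpleGraph.Walk.support_map _ p ▸ hv)
    exact w.2
  · rintro ⟨p, hp⟩
    exact ⟨hp _ p.start_mem_support, hp _ p.end_mem_support, ⟨p.induce ω hp⟩⟩

theorem SameCluster.symm (H : SameCluster G ω g h) : SameCluster G ω h g := by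
  obtain ⟨hg, hh, H⟩ := H
  exact ⟨hh, hg, H.symm⟩

theorem SameCluster.trans (H : SameCluster G ω g h) (H' : SameCluster G ω h k) :
    SameCluster G ω g k := by
  obtain ⟨hg, _, H⟩ := H
  obtain ⟨_, hk, H'⟩ := H'
  exact ⟨hg, hk, H.trans H'⟩

theorem sameCluster_self_iff : SameCluster G ω g g ↔ g ∈ ω :=
  ⟨fun H => H.1, fun H => ⟨H, H, SimpleGraph.Reachable.refl _⟩⟩

theorem measurableSet_sameCluster [Countable V] (G : SimpleGraph V) (g h : V) :
    MeasurableSet {ω : Set V | SameCluster G ω g h} := by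
  have : {ω : Set V | SameCluster G ω g h} =
      ⋃ l ∈ {l : List V | ∃ p : G.Walk g h, p.support = l}, ⋂ v ∈ {v | v ∈ l},
        {ω : Set V | v ∈ ω} := by
    ext ω
    simp [sameCluster_iff_exists_walk]
  rw [this]
  exact MeasurableSet.biUnion (Set.to_countable _) fun l _ =>
    MeasurableSet.biInter (Set.to_countable _) fun v _ => measurableSet_setOfPred.2 (measurable_set_mem v)

end Cluster

/-- Grouping terms by equivalence class turns the double sum into a sum of squares. Reflexivity is
not assumed, since closed sites belong to no cluster; the condition `R g g` discards them. -/
theorem sum_mul_mul_indicator_nonneg {T : Type u} {R : T → T → Prop} [DecidableRel R]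
    (hsymm : ∀ {a b}, R a b → R b a) (htrans : ∀ {a b c}, R a b → R b c → R a c)
    (s : Finset T) (x : T → ℝ) :
    0 ≤ ∑ g ∈ s, ∑ h ∈ s, x g * x h * (if R g h then 1 else 0) := by
  classical
  let cl : T → Set T := fun g => {k | R g k}
  have key : ∀ g h, (if R g h then (1 : ℝ) else 0) =
      if R g g ∧ R h h ∧ cl g = cl h then 1 else 0 := fun g h => by
    refine if_congr ⟨fun H => ⟨htrans H (hsymm H), htrans (hsymm H) H, ?_⟩, fun H => ?_⟩ rfl rfl
    · ext k
      exact ⟨fun H' => htrans (hsymm H) H', fun H' => htrans H H'⟩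
    · have : h ∈ cl h := H.2.1
      rw [← H.2.2] at this
      exact this
  have h2 : ∑ g ∈ s, ∑ h ∈ s, x g * x h * (if R g h then 1 else 0) =
      ∑ C ∈ s.image cl, (∑ g ∈ s, if R g g ∧ cl g = C then x g else 0) ^ 2 := by
    simp_rw [pow_two, Finset.sum_mul_sum]
    rw [Finset.sum_comm' (t' := s) (s' := fun _ => s.image cl) (by simp [and_comm])]
    refine Finset.sum_congr rfl fun g hg => ?_
    rw [Finset.sum_comm]
    refine Finset.sum_congr rfl fun h hh => ?_
    rw [key, Finset.sum_eq_single (cl g)]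
    · by_cases h1 : R g g <;> by_cases h2 : R h h <;> by_cases h3 : cl g = cl h <;>
        simp [h1, h2, h3, eq_comm]
    · intro C _ hC
      simp [hC.symm]
    · intro H
      exact absurd (Finset.mem_image_of_mem cl hg) H
  rw [h2]
  exact Finset.sum_nonneg fun _ _ => sq_nonneg _

section TwoPoint

variable {V : Type u} (G : SimpleGraph V) (P : Measure (Set V))

/-- The form is the expectation of its configuration-wise version, which is nonnegative by
`sum_mul_mul_indicator_nonneg`. -/
theorem kernelForm_twoPointFunction_nonneg [Countable V] [IsProbabilityMeasure P] (x : V →₀ ℝ) :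
    0 ≤ kernelForm (twoPointFunction G P) x x := by
  classical
  have h1 : ∀ g h, twoPointFunction G P g h =
      ∫ ω, (if SameCluster G ω g h then (1 : ℝ) else 0) ∂P := fun g h => by
    rw [twoPointFunction, ← integral_indicator_one (measurableSet_sameCluster G g h)]
    rfl
  have hint : ∀ g h, Integrable (fun ω => if SameCluster G ω g h then (1 : ℝ) else 0) P :=
    fun g h => (integrable_const (1 : ℝ)).indicator (measurableSet_sameCluster G g h)
  rw [kernelForm_apply]
  simp_rw [h1, ← integral_const_mul]
  have h2 : ∀ g ∈ x.support, ∑ h ∈ x.support, ∫ ω, x g * x h *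
      (if SameCluster G ω g h then (1 : ℝ) else 0) ∂P = ∫ ω, ∑ h ∈ x.support, x g * x h *
      (if SameCluster G ω g h then (1 : ℝ) else 0) ∂P := fun g _ =>
    (integral_finsetSum _ fun h _ => (hint g h).const_mul _).symm
  rw [Finset.sum_congr rfl h2, ← integral_finsetSum _ fun g _ =>
    integrable_finsetSum _ fun h _ => (hint g h).const_mul _]
  exact integral_nonneg fun ω =>
    sum_mul_mul_indicator_nonneg (fun H => H.symm) (fun H H' => H.trans H') x.support x

theorem twoPointFunction_comm (g h : V) : twoPointFunction G P g h = twoPointFunction G P h g := by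
  rw [twoPointFunction, twoPointFunction]
  congr 1
  ext ω
  exact ⟨fun H => H.symm, fun H => H.symm⟩

theorem twoPointFunction_le_self [IsProbabilityMeasure P] (g h : V) :
    twoPointFunction G P g h ≤ twoPointFunction G P g g :=
  measureReal_mono fun _ H => H.trans H.symm

theorem twoPointFunction_self (g : V) :
    twoPointFunction G P g g = P.real {ω : Set V | g ∈ ω} := by
  rw [twoPointFunction]
  simp_rw [sameCluster_self_iff]

/-- If all `p.length + 1` vertices of the walk are open then its ends are connected; a union bound
over closed vertices does the rest. -/
theorem one_sub_twoPointFunction_le [Countable V] [IsProbabilityMeasure P] {δ : ℝ}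
    (hδ : ∀ g, 1 - P.real {ω : Set V | g ∈ ω} ≤ δ) {g h : V} (p : G.Walk g h) :
    1 - twoPointFunction G P g h ≤ (p.length + 1) * δ := by
  have hmeas : ∀ v : V, MeasurableSet {ω : Set V | v ∈ ω} := fun v =>
    measurableSet_setOfPred.2 (measurable_set_mem v)
  rw [twoPointFunction, ← probReal_compl_eq_one_sub (measurableSet_sameCluster G g h)]
  suffices H : ∀ l : List V, P.real {ω : Set V | ∀ v ∈ l, v ∈ ω}ᶜ ≤ l.length * δ by
    refine (measureReal_mono (Set.compl_subset_compl.2 fun ω hω => ?_)).trans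
      ((H p.support).trans_eq (by simp))
    exact sameCluster_iff_exists_walk.2 ⟨p, hω⟩
  intro l
  induction l with
  | nil => simp
  | cons a l ih =>
    have : {ω : Set V | ∀ v ∈ a :: l, v ∈ ω}ᶜ =
        {ω : Set V | a ∈ ω}ᶜ ∪ {ω : Set V | ∀ v ∈ l, v ∈ ω}ᶜ := by
      ext ω
      simp only [List.mem_cons, forall_eq_or_imp, Set.mem_compl_iff, Set.mem_ofPred_eq,
        Set.mem_union]
      tauto
    rw [this]
    refine (measureReal_union_le _ _).trans ?_
    rw [probReal_compl_eq_one_sub (hmeas a)]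
    push_cast [List.length_cons]
    linarith [hδ a]

end TwoPoint

/-! ### Cayley graphs and invariance under left translation -/

section Group

variable {Γ : Type u} [Group Γ]

theorem SimpleGraph.mulCayley_connected {S : Set Γ} (hS : Subgroup.closure S = ⊤) :
    (SimpleGraph.mulCayley S).Connected := by
  have hstep : ∀ g : Γ, ∀ s ∈ S, (SimpleGraph.mulCayley S).Reachable g (g * s) := fun g s hs => by
    by_cases h : g = g * s
    · rw [← h]
    · exact SimpleGraph.Adj.reachable
        ((SimpleGraph.mulCayley_adj' S g (g * s)).2 ⟨h, s, hs, Or.inl rfl⟩)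
  have h1 : ∀ x : Γ, ∀ g : Γ, (SimpleGraph.mulCayley S).Reachable g (g * x) := by
    intro x
    have hx : x ∈ Subgroup.closure S := by rw [hS]; trivial
    induction hx using Subgroup.closure_induction with
    | mem s hs => exact fun g => hstep g s hs
    | one => intro g; rw [mul_one]
    | mul a b _ _ iha ihb =>
      intro g
      rw [← mul_assoc]
      exact (iha g).trans (ihb _)
    | inv a _ iha =>
      intro g
      simpa using (iha (g * a⁻¹)).symm
  have : Nonempty Γ := ⟨1⟩
  refine ⟨fun g h => ?_⟩
  simpa using h1 (g⁻¹ * h) g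

/-- Left translation as an automorphism of a Cayley graph. -/
def SimpleGraph.mulCayleyLeftIso (S : Set Γ) (γ : Γ) :
    SimpleGraph.mulCayley S ≃g SimpleGraph.mulCayley S where
  toEquiv := Equiv.mulLeft γ
  map_rel_iff' := SimpleGraph.mulCayley_adj_mul_iff_right

theorem SimpleGraph.mulCayley_finite_ball {S : Set Γ} (hS : S.Finite) (hS' : Subgroup.closure S = ⊤)
    (r : ℕ) : {g : Γ | (SimpleGraph.mulCayley S).dist 1 g ≤ r}.Finite := by
  have h1 : ∀ (g h : Γ) (p : (SimpleGraph.mulCayley S).Walk g h),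
      g⁻¹ * h ∈ (S ∪ S⁻¹) ^ p.length := by
    intro g h p
    induction p with
    | nil => simp
    | @cons a b c hab q ih =>
      rw [SimpleGraph.Walk.length_cons, pow_succ']
      refine Set.mem_mul.2 ⟨a⁻¹ * b, ?_, b⁻¹ * c, ih, by group⟩
      obtain ⟨-, s, hs, rfl | rfl⟩ := (SimpleGraph.mulCayley_adj' S a b).1 hab
      · left; simpa using hs
      · right; simpa using hs
  have hpow : ∀ n : ℕ, ((S ∪ S⁻¹) ^ n).Finite := fun n => by
    induction n with
    | zero => simp
    | succ n ih => rw [pow_succ]; exact ih.mul (hS.union hS.inv)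
  have hfin : (⋃ n ∈ Set.Iic r, (S ∪ S⁻¹) ^ n).Finite :=
    (Set.finite_Iic r).biUnion fun n _ => hpow n
  refine hfin.subset fun g hg => ?_
  obtain ⟨p, hp⟩ := (SimpleGraph.mulCayley_connected hS').exists_walk_length_eq_dist 1 g
  refine Set.mem_biUnion (x := p.length) (by rw [Set.mem_Iic, hp]; exact hg) ?_
  simpa using h1 1 g p

theorem SimpleGraph.mulCayley_dist_mul_left {S : Set Γ} (hS : Subgroup.closure S = ⊤) (γ g h : Γ) :
    (SimpleGraph.mulCayley S).dist (γ * g) (γ * h) = (SimpleGraph.mulCayley S).dist g h := by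
  have key : ∀ γ g h : Γ,
      (SimpleGraph.mulCayley S).dist (γ * g) (γ * h) ≤ (SimpleGraph.mulCayley S).dist g h := by
    intro γ g h
    obtain ⟨p, hp⟩ := (SimpleGraph.mulCayley_connected hS).exists_walk_length_eq_dist g h
    rw [← hp, ← SimpleGraph.Walk.length_map (SimpleGraph.mulCayleyLeftIso S γ).toHom p]
    exact SimpleGraph.dist_le _
  refine le_antisymm (key γ g h) ?_
  simpa using key γ⁻¹ (γ * g) (γ * h)

theorem sameCluster_smul_iff (S : Set Γ) (γ g h : Γ) (ω : Set Γ) :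
    SameCluster (SimpleGraph.mulCayley S) (γ • ω) (γ * g) (γ * h) ↔
      SameCluster (SimpleGraph.mulCayley S) ω g h := by
  have key : ∀ (γ g h : Γ) (ω : Set Γ), SameCluster (SimpleGraph.mulCayley S) ω g h →
      SameCluster (SimpleGraph.mulCayley S) (γ • ω) (γ * g) (γ * h) := by
    intro γ g h ω H
    obtain ⟨p, hp⟩ := sameCluster_iff_exists_walk.1 H
    refine sameCluster_iff_exists_walk.2
      ⟨p.map (SimpleGraph.mulCayleyLeftIso S γ).toHom, fun v hv => ?_⟩
    obtain ⟨w, hw, rfl⟩ := List.mem_map.1 (SimpleGraph.Walk.support_map _ p ▸ hv)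
    exact Set.smul_mem_smul_set (hp w hw)
  refine ⟨fun H => ?_, key γ g h ω⟩
  simpa using key γ⁻¹ _ _ _ H

variable {P : Measure (Set Γ)}

theorem IsInvariantSitePercolation.measureReal_preimage (hP : IsInvariantSitePercolation P) (γ : Γ)
    {A : Set (Set Γ)} (hA : MeasurableSet A) : P.real {ω | γ • ω ∈ A} = P.real A := by
  conv_rhs => rw [← hP.map_smul γ]
  rw [map_measureReal_apply (measurable_smul_configuration γ) hA]
  rfl

theorem IsInvariantSitePercolation.twoPointFunction_mul_left [Countable Γ]
    (hP : IsInvariantSitePercolation P) (S : Set Γ) (γ g h : Γ) :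
    twoPointFunction (SimpleGraph.mulCayley S) P (γ * g) (γ * h) =
      twoPointFunction (SimpleGraph.mulCayley S) P g h := by
  rw [twoPointFunction, ← hP.measureReal_preimage γ (measurableSet_sameCluster _ _ _)]
  simp_rw [Set.mem_ofPred_eq, sameCluster_smul_iff]
  rfl

end Group

/-! ### From percolations to the Haagerup property -/

theorem countable_of_closure_eq_top {Γ : Type u} [Group Γ] (S : Finset Γ)
    (hS : Subgroup.closure (S : Set Γ) = ⊤) : Countable Γ := by
  have h1 : (Set.univ : Set Γ) =
      ⋃ r : ℕ, {g : Γ | (SimpleGraph.mulCayley (S : Set Γ)).dist 1 g ≤ r} := by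
    ext g
    simpa using ⟨_, le_rfl⟩
  rw [← Set.countable_univ_iff, h1]
  exact Set.countable_iUnion fun r =>
    (SimpleGraph.mulCayley_finite_ball S.finite_toSet hS r).countable

theorem hasHaagerupProperty_of_percolations {Γ : Type u} [Group Γ] (S : Finset Γ)
    (hS : Subgroup.closure (S : Set Γ) = ⊤)
    (H : ∀ α : ℝ, α < 1 → ∃ P : Measure (Set Γ), IsInvariantSitePercolation P ∧
      α < P.real {ω : Set Γ | (1 : Γ) ∈ ω} ∧
      VanishesAtInfinity (SimpleGraph.mulCayley (S : Set Γ))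
        (twoPointFunction (SimpleGraph.mulCayley (S : Set Γ)) P)) :
    HasHaagerupProperty Γ := by
  have : Countable Γ := countable_of_closure_eq_top S hS
  set G := SimpleGraph.mulCayley (S : Set Γ) with hG
  -- The defects `2 ^ (-(n + 1))` are summable, and the shift in the exponent keeps even the first
  -- one at most `1 / 2`, as properness needs below.
  have hδ : ∀ n : ℕ, 1 - (1 / 2 : ℝ) ^ (n + 1) < 1 := fun n => by
    have : (0 : ℝ) < (1 / 2) ^ (n + 1) := by positivity
    linarith
  choose P hP hPα hPv using fun n : ℕ => H _ (hδ n)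
  have hprob : ∀ n, IsProbabilityMeasure (P n) := fun n => (hP n).isProbabilityMeasure
  let τ : ℕ → Γ → Γ → ℝ := fun n => twoPointFunction G (P n)
  have hτinv : ∀ n γ g h, τ n (γ * g) (γ * h) = τ n g h := fun n γ g h =>
    (hP n).twoPointFunction_mul_left S γ g h
  have hτle : ∀ n g h, τ n g h ≤ 1 := fun n g h => measureReal_le_one
  have hδ' : ∀ n g, 1 - (P n).real {ω : Set Γ | g ∈ ω} ≤ (1 / 2 : ℝ) ^ (n + 1) := fun n g => by
    have h1 : (P n).real {ω : Set Γ | g ∈ ω} = (P n).real {ω : Set Γ | (1 : Γ) ∈ ω} := by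
      rw [← twoPointFunction_self G, ← twoPointFunction_self G]
      simpa using hτinv n g 1 1
    rw [h1]
    linarith [hPα n]
  have hsum : ∀ g h, Summable fun n => τ n g h - 1 := fun g h => by
    obtain ⟨p⟩ := (SimpleGraph.mulCayley_connected hS).preconnected g h
    have hgeom : Summable fun n : ℕ => ((p.length : ℝ) + 1) * (1 / 2 : ℝ) ^ (n + 1) :=
      ((summable_nat_add_iff 1).2 summable_geometric_two).mul_left _
    refine Summable.of_norm_bounded hgeom fun n => ?_
    rw [Real.norm_eq_abs, abs_sub_comm, abs_of_nonneg (sub_nonneg.2 (hτle n g h))]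
    exact one_sub_twoPointFunction_le G (P n) (hδ' n) p
  refine hasHaagerupProperty_of_kernel (fun g h => ∑' n, (τ n g h - 1)) (fun g h => ?_)
    (fun γ g h => ?_) (fun x hx => ?_) (fun M => ?_)
  · exact tsum_congr fun n => by simp only [τ, twoPointFunction_comm G (P n) g h]
  · exact tsum_congr fun n => by rw [hτinv]
  -- Subtracting `1` from the kernel secures convergence and costs nothing here: a constant kernel
  -- contributes a multiple of the squared total mass, which is zero.
  · have h1 : ∀ n, ∑ g ∈ x.support, ∑ h ∈ x.support, x g * x h * (τ n g h - 1) =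
        kernelForm (τ n) x x := fun n => by
      rw [kernelForm_apply]
      simp_rw [mul_sub, mul_one, Finset.sum_sub_distrib]
      rw [← Finset.sum_mul_sum, ← totalMass_apply, hx]
      ring
    have h2 : kernelForm (fun g h => ∑' n, (τ n g h - 1)) x x =
        ∑' n, ∑ g ∈ x.support, ∑ h ∈ x.support, x g * x h * (τ n g h - 1) := by
      rw [kernelForm_apply, Summable.tsum_finsetSum fun g _ => summable_sum fun h _ =>
        (hsum g h).mul_left _]
      refine Finset.sum_congr rfl fun g _ => ?_
      rw [Summable.tsum_finsetSum fun h _ => (hsum g h).mul_left _]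
      exact Finset.sum_congr rfl fun h _ => (tsum_mul_left).symm
    rw [h2]
    refine tsum_nonneg fun n => ?_
    rw [h1]
    exact kernelForm_twoPointFunction_nonneg G (P n) x
  -- Beyond the radii of the first `N` percolations each term `τ n 1 1 - τ n 1 g` is at least `1 / 2
  -- - 1 / 4`, so the sum is at least `N / 4 > M`.
  · obtain ⟨N, hN⟩ := exists_nat_gt (4 * M)
    choose r hr using fun n => hPv n (1 / 4) (by norm_num)
    refine (SimpleGraph.mulCayley_finite_ball S.finite_toSet hS
      ((Finset.range N).sup r)).subset fun g hg => ?_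
    change ∑' n, (τ n 1 1 - 1) - ∑' n, (τ n 1 g - 1) ≤ M at hg
    change G.dist 1 g ≤ _
    by_contra! hlt
    rw [← (hsum 1 1).tsum_sub (hsum 1 g)] at hg
    have hnn : ∀ n, 0 ≤ τ n 1 1 - 1 - (τ n 1 g - 1) := fun n => by
      linarith [twoPointFunction_le_self G (P n) 1 g]
    have h3 : ∑ n ∈ Finset.range N, (1 / 4 : ℝ) ≤
        ∑ n ∈ Finset.range N, (τ n 1 1 - 1 - (τ n 1 g - 1)) := by
      refine Finset.sum_le_sum fun n hn => ?_
      have h4 : τ n 1 g ≤ 1 / 4 :=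
        (le_abs_self _).trans (hr n 1 g ((Finset.le_sup hn).trans_lt hlt))
      have h5 : 1 - τ n 1 1 ≤ 1 / 2 := by
        have h6 := hδ' n 1
        rw [← twoPointFunction_self G] at h6
        refine h6.trans ?_
        rw [pow_succ]
        have : (1 / 2 : ℝ) ^ n ≤ 1 := pow_le_one₀ (by norm_num) (by norm_num)
        linarith
      linarith
    have h7 := ((hsum 1 1).sub (hsum 1 g)).sum_le_tsum (Finset.range N) fun n _ => hnn n
    simp only [Finset.sum_const, Finset.card_range, nsmul_eq_mul] at h3
    linarith

/-! ### Gaussian processes with prescribed covariance -/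

open ProbabilityTheory

theorem measurable_linearCombination_left {T : Type u} (c : T →₀ ℝ) :
    Measurable fun x : T → ℝ => Finsupp.linearCombination ℝ x c := by
  simp only [Finsupp.linearCombination_apply, Finsupp.sum, smul_eq_mul]
  fun_prop

/-- The Cramér–Wold device: the law of a real-valued process is determined by the laws of finite
linear combinations of its values. -/
theorem Measure.ext_of_map_linearCombination {T : Type u} {μ ν : Measure (T → ℝ)}
    [IsProbabilityMeasure μ] [IsProbabilityMeasure ν]
    (H : ∀ c : T →₀ ℝ, μ.map (fun x => Finsupp.linearCombination ℝ x c) =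
      ν.map (fun x => Finsupp.linearCombination ℝ x c)) : μ = ν := by
  classical
  refine IsProjectiveLimit.unique (P := fun I => ν.map I.restrict) (fun I => ?_) fun I => rfl
  have hm : Measurable (I.restrict : (T → ℝ) → (I → ℝ)) := Finset.measurable_restrict I
  have : IsProbabilityMeasure (μ.map (I.restrict : (T → ℝ) → (I → ℝ))) :=
    Measure.isProbabilityMeasure_map hm.aemeasurable
  have : IsProbabilityMeasure (ν.map (I.restrict : (T → ℝ) → (I → ℝ))) :=
    Measure.isProbabilityMeasure_map hm.aemeasurable
  refine Measure.ext_of_charFunDual (funext fun L => ?_)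
  let c : T →₀ ℝ := ∑ i : I, Finsupp.single (i : T) (L (Pi.single i 1))
  have hc : ∀ x : T → ℝ, L (I.restrict x) = Finsupp.linearCombination ℝ x c := fun x => by
    have h1 : I.restrict x = ∑ i : I, x i • (Pi.single i 1 : I → ℝ) := by
      ext j
      simp [Finset.sum_apply, Pi.single_apply]
    rw [h1, map_sum, map_sum]
    refine Finset.sum_congr rfl fun i _ => ?_
    rw [map_smul, Finsupp.linearCombination_single, smul_eq_mul, smul_eq_mul, mul_comm]
  rw [charFunDual_eq_charFun_map_one, charFunDual_eq_charFun_map_one,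
    Measure.map_map L.continuous.measurable hm, Measure.map_map L.continuous.measurable hm]
  have h2 : ⇑L ∘ (I.restrict : (T → ℝ) → (I → ℝ)) =
      fun x => Finsupp.linearCombination ℝ x c := funext hc
  rw [h2, H]

theorem map_sum_infinitePi_gaussianReal {ι : Type u} (a : ι → ℝ) (s : Finset ι) :
    (Measure.infinitePi fun _ : ι => gaussianReal 0 1).map (fun ξ => ∑ i ∈ s, a i * ξ i) =
      gaussianReal 0 (∑ i ∈ s, a i ^ 2).toNNReal := by
  classical
  set μ := Measure.infinitePi fun _ : ι => gaussianReal 0 1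
  have hmeas : ∀ i, Measurable fun y : ℝ => a i * y := fun i => by fun_prop
  have hind : iIndepFun (fun i (ξ : ι → ℝ) => a i * ξ i) μ := iIndepFun_infinitePi hmeas
  have hone : ∀ i, μ.map (fun ξ => a i * ξ i) = gaussianReal 0 (a i ^ 2).toNNReal := fun i => by
    have h1 : (fun ξ : ι → ℝ => a i * ξ i) = (fun y => a i * y) ∘ Function.eval i := rfl
    rw [h1, ← Measure.map_map (hmeas i) (measurable_pi_apply i), Measure.infinitePi_map_eval,
      gaussianReal_map_const_mul]
    congr 1
    · simp
    · ext; simp [Real.coe_toNNReal _ (sq_nonneg (a i))]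
  induction s using Finset.induction_on with
  | empty => simp
  | insert i s hi ih =>
    have h2 := hind.indepFun_finsetSum_of_notMem (fun i => by fun_prop) hi
    have h3 : (∑ j ∈ s, fun ξ : ι → ℝ => a j * ξ j) = fun ξ => ∑ j ∈ s, a j * ξ j := by
      ext ξ; simp
    rw [h3] at h2
    have h4 := gaussianReal_add_gaussianReal_of_indepFun h2 ih (hone i)
    rw [add_zero, ← Real.toNNReal_add (Finset.sum_nonneg fun j _ => sq_nonneg _) (sq_nonneg _)] at h4
    simp_rw [Finset.sum_insert hi]
    rw [add_comm (a i ^ 2), ← h4]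
    congr 1
    ext ξ
    simp [add_comm]

theorem linearCombination_comp_linearCombination {T ι W : Type*} [AddCommGroup W] [Module ℝ W]
    (w : ι → W) (a : T → ι →₀ ℝ) (c : T →₀ ℝ) :
    Finsupp.linearCombination ℝ (fun t => Finsupp.linearCombination ℝ w (a t)) c =
      Finsupp.linearCombination ℝ w (Finsupp.linearCombination ℝ a c) := by
  simp only [Finsupp.linearCombination_apply ℝ c, Finsupp.sum, map_sum, map_smul]

/-- Existence of the centered Gaussian process with covariance `⟪b s, b t⟫`. -/
theorem exists_gaussian_process {T : Type u} [Countable T] [Nonempty T] {H : Type u}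
    [NormedAddCommGroup H] [InnerProductSpace ℝ H] (b : T → H) :
    ∃ μ : Measure (T → ℝ), IsProbabilityMeasure μ ∧ ∀ c : T →₀ ℝ,
      μ.map (fun x => Finsupp.linearCombination ℝ x c) =
        gaussianReal 0 (‖Finsupp.linearCombination ℝ b c‖ ^ 2).toNNReal := by
  obtain ⟨f, hf⟩ := exists_surjective_nat T
  -- The nonzero Gram–Schmidt vectors are orthonormal and their algebraic span contains every `b t`.
  -- Each value of the process is thus a finite combination of independent standard Gaussians, and
  -- no limits are needed.
  let ι := {i | InnerProductSpace.gramSchmidtNormed ℝ (b ∘ f) i ≠ 0}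
  let e : ι → H := fun i => InnerProductSpace.gramSchmidtNormed ℝ (b ∘ f) i
  have he : Orthonormal ℝ e := InnerProductSpace.gramSchmidtNormed_orthonormal' (b ∘ f)
  have hspan : Submodule.span ℝ (Set.range b) ≤ Submodule.span ℝ (Set.range e) := by
    rw [← hf.range_comp b, ← InnerProductSpace.span_gramSchmidt ℝ (b ∘ f),
      ← InnerProductSpace.span_gramSchmidtNormed_range, Submodule.span_le]
    rintro _ ⟨i, rfl⟩
    by_cases hi : InnerProductSpace.gramSchmidtNormed ℝ (b ∘ f) i = 0
    · rw [hi]; exact Submodule.zero_mem _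
    · exact Submodule.subset_span ⟨⟨i, hi⟩, rfl⟩
  have hmem : ∀ t, ∃ a : ι →₀ ℝ, Finsupp.linearCombination ℝ e a = b t := fun t => by
    have := hspan (Submodule.subset_span ⟨t, rfl⟩)
    rwa [← Finsupp.range_linearCombination] at this
  choose a ha using hmem
  have hX : Measurable fun (ξ : ι → ℝ) (t : T) => Finsupp.linearCombination ℝ ξ (a t) :=
    measurable_pi_lambda _ fun t => measurable_linearCombination_left (a t)
  refine ⟨(Measure.infinitePi fun _ : ι => gaussianReal 0 1).map
    fun ξ t => Finsupp.linearCombination ℝ ξ (a t), Measure.isProbabilityMeasure_map hX.aemeasurable,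
    fun c => ?_⟩
  rw [Measure.map_map (measurable_linearCombination_left c) hX]
  let d : ι →₀ ℝ := Finsupp.linearCombination ℝ a c
  have h2 : (Finsupp.linearCombination ℝ b c) = Finsupp.linearCombination ℝ e d := by
    rw [← linearCombination_comp_linearCombination]
    simp_rw [ha]
  have h3 : ‖Finsupp.linearCombination ℝ b c‖ ^ 2 = ∑ i ∈ d.support, d i ^ 2 := by
    rw [h2, ← real_inner_self_eq_norm_sq, he.inner_finsupp_eq_sum_left]
    simp [Finsupp.sum, pow_two]
  rw [h3, ← map_sum_infinitePi_gaussianReal]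
  congr 1
  ext ξ
  change Finsupp.linearCombination ℝ (fun t => Finsupp.linearCombination ℝ ξ (a t)) c = _
  rw [linearCombination_comp_linearCombination]
  simp [d, Finsupp.linearCombination_apply _ (Finsupp.linearCombination ℝ a c), Finsupp.sum]

/-- The density is bounded by `1 / σ` and the interval has length `2 * a`. -/
theorem gaussianReal_Icc_le {σ : ℝ} (hσ : 0 < σ) (a : ℝ) :
    gaussianReal 0 (σ ^ 2).toNNReal (Set.Icc (-a) a) ≤ ENNReal.ofReal (2 * a / σ) := by
  have hv : (σ ^ 2).toNNReal ≠ 0 := by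
    rw [ne_eq, Real.toNNReal_eq_zero, not_le]; positivity
  have hpdf : ∀ x, gaussianPDF 0 (σ ^ 2).toNNReal x ≤ ENNReal.ofReal σ⁻¹ := fun x => by
    refine ENNReal.ofReal_le_ofReal ?_
    rw [gaussianPDFReal, Real.coe_toNNReal _ (sq_nonneg σ)]
    have h1 : σ ≤ √(2 * Real.pi * σ ^ 2) := by
      refine Real.le_sqrt_of_sq_le ?_
      nlinarith [Real.pi_gt_three, sq_nonneg σ]
    have h2 : Real.exp (-(x - 0) ^ 2 / (2 * σ ^ 2)) ≤ 1 := by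
      rw [Real.exp_le_one_iff, neg_div]
      exact neg_nonpos.2 (by positivity)
    calc _ ≤ (√(2 * Real.pi * σ ^ 2))⁻¹ * 1 := by gcongr
      _ ≤ σ⁻¹ := by rw [mul_one]; gcongr
  rw [gaussianReal_apply 0 hv]
  calc _ ≤ ∫⁻ _ in Set.Icc (-a) a, ENNReal.ofReal σ⁻¹ := lintegral_mono hpdf
    _ = ENNReal.ofReal (2 * a / σ) := by
      rw [setLIntegral_const, Real.volume_Icc, ← ENNReal.ofReal_mul (by positivity)]
      congr 1
      field_simp
      ring

/-! ### Percolation from randomly shifted unit cells -/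

/-- The uniform probability measure on the unit interval. -/
noncomputable def uniformUnit : Measure ℝ := volume.restrict (Set.Ioc 0 1)

instance : IsProbabilityMeasure uniformUnit := ⟨by simp [uniformUnit]⟩

/-- This is translation invariance of Lebesgue measure on the circle `ℝ / ℤ`. -/
theorem uniformUnit_preimage_add_of_periodic {B : Set ℝ} (hB : MeasurableSet B)
    (hper : ∀ u, u + 1 ∈ B ↔ u ∈ B) (c : ℝ) : uniformUnit {u | u + c ∈ B} = uniformUnit B := by
  have hc : MeasurableSet {u : ℝ | u + c ∈ B} := measurable_add_const c hB
  have hreal : ∀ C : Set ℝ, MeasurableSet C →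
      uniformUnit.real C = ∫ u in (0 : ℝ)..1, C.indicator (fun _ => (1 : ℝ)) u := fun C hC => by
    rw [intervalIntegral.integral_of_le zero_le_one, ← integral_indicator_one hC]
    rfl
  have hperiodic : Function.Periodic (B.indicator fun _ => (1 : ℝ)) 1 := fun u => by
    by_cases hu : u ∈ B
    · rw [Set.indicator_of_mem hu, Set.indicator_of_mem ((hper u).2 hu)]
    · rw [Set.indicator_of_notMem hu, Set.indicator_of_notMem (mt (hper u).1 hu)]
  rw [← measureReal_eq_measureReal_iff, hreal _ hc, hreal _ hB]
  have h1 : ∀ u, {u : ℝ | u + c ∈ B}.indicator (fun _ => (1 : ℝ)) u =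
      B.indicator (fun _ => (1 : ℝ)) (u + c) := fun u => rfl
  simp_rw [h1]
  rw [intervalIntegral.integral_comp_add_right (fun u => B.indicator (fun _ => (1 : ℝ)) u),
    zero_add, add_comm 1 c, hperiodic.intervalIntegral_add_eq c 0, zero_add]

/-- For `a ≤ b` the floors differ only if an integer lies in `(a + u, b + u]`. By periodicity one
may take `a = 0`, and then `u` must be within `b - a` of `1`. -/
theorem uniformUnit_floor_ne_le (a b : ℝ) :
    uniformUnit {u | ⌊a + u⌋ ≠ ⌊b + u⌋} ≤ ENNReal.ofReal |a - b| := by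
  wlog hab : a ≤ b generalizing a b
  · have := this b a (le_of_not_ge hab)
    rw [abs_sub_comm]
    simpa only [ne_comm] using this
  have hper : ∀ u : ℝ, u + 1 ∈ {u : ℝ | ⌊u⌋ ≠ ⌊b - a + u⌋} ↔ u ∈ {u : ℝ | ⌊u⌋ ≠ ⌊b - a + u⌋} :=
    fun u => by simp [← add_assoc]
  have hB : MeasurableSet {u : ℝ | ⌊u⌋ ≠ ⌊b - a + u⌋} :=
    (measurableSet_eq_fun (by fun_prop) (by fun_prop)).compl
  have h1 := uniformUnit_preimage_add_of_periodic hB hper a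
  have h2 : {u : ℝ | ⌊a + u⌋ ≠ ⌊b + u⌋} = {u | u + a ∈ {u : ℝ | ⌊u⌋ ≠ ⌊b - a + u⌋}} := by
    ext u
    have : b - a + (u + a) = b + u := by ring
    simp only [Set.mem_ofPred_eq, this]
    rw [add_comm u a]
  rw [h2, h1, uniformUnit, Measure.restrict_apply hB]
  calc _ ≤ volume (Set.Icc (1 - (b - a)) 1) := by
        refine measure_mono ?_
        rintro u ⟨hu, hu0, hu1⟩
        refine ⟨?_, hu1⟩
        by_contra! hlt
        have hu1' : u < 1 := by linarith
        refine hu ?_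
        rw [Int.floor_eq_zero_iff.2 ⟨hu0.le, hu1'⟩, eq_comm, Int.floor_eq_zero_iff]
        constructor <;> linarith
    _ = ENNReal.ofReal |a - b| := by
        rw [Real.volume_Icc, abs_sub_comm, abs_of_nonneg (sub_nonneg.2 hab)]
        congr 1
        ring

section FloorSites

variable {Γ : Type u} [Group Γ]

/-- The sites `g` such that `x` takes values in the same cell of the partition of `ℝ` into
unit intervals, shifted by `-u`, at `g` and at all its right translates by elements of `S`. -/
def floorSites (S : Finset Γ) (p : (Γ → ℝ) × ℝ) : Set Γ :=
  {g | ∀ s ∈ S, ⌊p.1 (g * s) + p.2⌋ = ⌊p.1 g + p.2⌋}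

theorem measurable_floorSites (S : Finset Γ) : Measurable (floorSites S) := by
  rw [measurable_set_iff]
  intro g
  refine measurableSet_setOfPred.1 ?_
  have : {p : (Γ → ℝ) × ℝ | g ∈ floorSites S p} =
      ⋂ s ∈ S, {p : (Γ → ℝ) × ℝ | ⌊p.1 (g * s) + p.2⌋ = ⌊p.1 g + p.2⌋} := by
    ext p
    simp [floorSites]
  rw [this]
  exact Finset.measurableSet_biInter _ fun s _ => measurableSet_eq_fun (by fun_prop) (by fun_prop)

theorem floorSites_add_one (S : Finset Γ) (x : Γ → ℝ) (u : ℝ) :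
    floorSites S (x, u + 1) = floorSites S (x, u) := by
  simp [floorSites, ← add_assoc]

/-- Left translation of real functions on a group, normalized to preserve vanishing at `1`. -/
def shiftField (γ : Γ) (x : Γ → ℝ) : Γ → ℝ := fun g => x (γ⁻¹ * g) - x γ⁻¹

theorem measurable_shiftField (γ : Γ) : Measurable (shiftField γ) :=
  measurable_pi_lambda _ fun g => by unfold shiftField; fun_prop

/-- Renormalizing the translated field to vanish at `1` changes only the offset. A uniform offset
absorbs this change modulo `1`, so stationary increments suffice for an invariant percolation. -/
theorem smul_floorSites (S : Finset Γ) (γ : Γ) (x : Γ → ℝ) (u : ℝ) :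
    γ • floorSites S (x, u) = floorSites S (shiftField γ x, u + x γ⁻¹) := by
  ext g
  rw [Set.mem_smul_set_iff_inv_smul_mem]
  have : ∀ g : Γ, x (γ⁻¹ * g) - x γ⁻¹ + (u + x γ⁻¹) = x (γ⁻¹ * g) + u := fun g => by ring
  simp only [floorSites, shiftField, smul_eq_mul, Set.mem_ofPred_eq, this, mul_assoc]

/-- Each edge is a right multiplication by some `s ∈ S` from one of its two ends, and openness of
that end equates the cells. Hence `floorSites` need not test inverses of generators. -/
theorem floor_eq_of_sameCluster {S : Finset Γ} {p : (Γ → ℝ) × ℝ} {g h : Γ}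
    (H : SameCluster (SimpleGraph.mulCayley (S : Set Γ)) (floorSites S p) g h) :
    ⌊p.1 g + p.2⌋ = ⌊p.1 h + p.2⌋ := by
  obtain ⟨w, hw⟩ := sameCluster_iff_exists_walk.1 H
  clear H
  induction w with
  | nil => rfl
  | @cons a b c hab q ih =>
    have h1 : a ∈ floorSites S p := hw a (by simp)
    have h2 : b ∈ floorSites S p := hw b (by simp)
    rw [← ih fun v hv => hw v (by simp [hv])]
    obtain ⟨-, s, hs, rfl | rfl⟩ := (SimpleGraph.mulCayley_adj' _ _ _).1 hab
    · exact (h1 s hs).symm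
    · exact h2 s hs

/-- The site percolation given by `floorSites` for a random field and an independent uniform
shift. -/
noncomputable def floorPercolation (S : Finset Γ) (μ : Measure (Γ → ℝ)) : Measure (Set Γ) :=
  (μ.prod uniformUnit).map (floorSites S)

theorem floorPercolation_isInvariant (S : Finset Γ) (μ : Measure (Γ → ℝ)) [IsProbabilityMeasure μ]
    (hμ : ∀ γ, μ.map (shiftField γ) = μ) : IsInvariantSitePercolation (floorPercolation S μ) where
  isProbabilityMeasure :=
    Measure.isProbabilityMeasure_map (measurable_floorSites S).aemeasurable
  map_smul γ := by
    have hm := measurable_floorSites S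
    have hγ := measurable_smul_configuration γ
    ext A hA
    rw [floorPercolation, Measure.map_apply hγ hA, Measure.map_apply hm (hγ hA),
      Measure.map_apply hm hA, Measure.prod_apply (hm (hγ hA)), Measure.prod_apply (hm hA)]
    have h1 : ∀ x : Γ → ℝ, uniformUnit (Prod.mk x ⁻¹' (floorSites S ⁻¹'
        ((fun ω : Set Γ => γ • ω) ⁻¹' A))) =
        uniformUnit (Prod.mk (shiftField γ x) ⁻¹' (floorSites S ⁻¹' A)) := fun x => by
      rw [← uniformUnit_preimage_add_of_periodic (measurable_prodMk_left (hm hA)) (fun u => by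
        simp only [Set.mem_preimage, floorSites_add_one]) (x γ⁻¹)]
      congr 1
      ext u
      simp only [Set.mem_preimage, Set.mem_ofPred_eq, smul_floorSites]
    simp_rw [h1]
    rw [← lintegral_map (f := fun y => uniformUnit (Prod.mk y ⁻¹' (floorSites S ⁻¹' A)))
      (measurable_measure_prodMk_left (hm hA)) (measurable_shiftField γ), hμ]

/-- A union bound over `S`, with the field fixed and only the offset random in
`uniformUnit_floor_ne_le`. -/
theorem floorPercolation_one_notMem_le (S : Finset Γ) (μ : Measure (Γ → ℝ))
    [IsProbabilityMeasure μ] :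
    floorPercolation S μ {ω : Set Γ | (1 : Γ) ∈ ω}ᶜ ≤
      ∑ s ∈ S, ∫⁻ x, ENNReal.ofReal |x s - x 1| ∂μ := by
  have hm : MeasurableSet {ω : Set Γ | (1 : Γ) ∈ ω} :=
    measurableSet_setOfPred.2 (measurable_set_mem 1)
  rw [floorPercolation, Measure.map_apply (measurable_floorSites S) hm.compl]
  have h1 : floorSites S ⁻¹' {ω : Set Γ | (1 : Γ) ∈ ω}ᶜ ⊆
      ⋃ s ∈ S, {p : (Γ → ℝ) × ℝ | ⌊p.1 s + p.2⌋ ≠ ⌊p.1 1 + p.2⌋} := by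
    intro p hp
    simpa [floorSites] using hp
  refine (measure_mono h1).trans ((measure_biUnion_finset_le _ _).trans
    (Finset.sum_le_sum fun s _ => ?_))
  have hs : MeasurableSet {p : (Γ → ℝ) × ℝ | ⌊p.1 s + p.2⌋ ≠ ⌊p.1 1 + p.2⌋} :=
    (measurableSet_eq_fun (by fun_prop) (by fun_prop)).compl
  rw [Measure.prod_apply hs]
  exact lintegral_mono fun x => uniformUnit_floor_ne_le (x s) (x 1)

theorem floorPercolation_twoPointFunction_le [Countable Γ] (S : Finset Γ) (μ : Measure (Γ → ℝ))
    [IsProbabilityMeasure μ] (g h : Γ) :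
    twoPointFunction (SimpleGraph.mulCayley (S : Set Γ)) (floorPercolation S μ) g h ≤
      μ.real {x | x g - x h ∈ Set.Icc (-1 : ℝ) 1} := by
  have hm : MeasurableSet {x : Γ → ℝ | x g - x h ∈ Set.Icc (-1 : ℝ) 1} :=
    ((measurable_pi_apply g).sub (measurable_pi_apply h)) measurableSet_Icc
  rw [twoPointFunction, floorPercolation, map_measureReal_apply (measurable_floorSites S)
    (measurableSet_sameCluster _ _ _)]
  have h1 : μ.real {x : Γ → ℝ | x g - x h ∈ Set.Icc (-1 : ℝ) 1} =
      (μ.prod uniformUnit).real ({x : Γ → ℝ | x g - x h ∈ Set.Icc (-1 : ℝ) 1} ×ˢ Set.univ) := by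
    rw [measureReal_prod_prod]; simp
  rw [h1]
  refine measureReal_mono fun p hp => ⟨?_, trivial⟩
  have h2 := Int.abs_sub_lt_one_of_floor_eq_floor (floor_eq_of_sameCluster hp)
  rw [add_sub_add_right_eq_sub] at h2
  exact abs_le.1 h2.le

end FloorSites

/-! ### Percolation from a Gaussian field with stationary increments -/

theorem lintegral_abs_gaussianReal (σ : ℝ) :
    ∫⁻ y, ENNReal.ofReal |y| ∂gaussianReal 0 (σ ^ 2).toNNReal =
      ENNReal.ofReal |σ| * ∫⁻ y, ENNReal.ofReal |y| ∂gaussianReal 0 1 := by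
  have h1 : gaussianReal 0 (σ ^ 2).toNNReal = (gaussianReal 0 1).map (σ * ·) := by
    rw [gaussianReal_map_const_mul]
    congr 1
    · simp
    · ext; simp [Real.coe_toNNReal _ (sq_nonneg σ)]
  rw [h1, lintegral_map (by fun_prop) (by fun_prop), ← lintegral_const_mul _ (by fun_prop)]
  simp_rw [abs_mul, ENNReal.ofReal_mul (abs_nonneg σ)]

theorem lintegral_abs_gaussianReal_ne_top :
    ∫⁻ y, ENNReal.ofReal |y| ∂gaussianReal 0 1 ≠ ⊤ := by
  have h1 : Integrable (fun y : ℝ => y) (gaussianReal 0 1) := IsGaussian.integrable_id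
  have h2 := h1.2
  rw [hasFiniteIntegral_iff_norm] at h2
  exact h2.ne

/-- Moves a shift from the vectors to the coefficients. It serves twice: for the sampled field, with
values in `ℝ`, and for the cocycle, with values in `H`. -/
theorem linearCombination_leftTranslate_sub {Γ W : Type*} [Group Γ] [AddCommGroup W] [Module ℝ W]
    (γ : Γ) (w : Γ → W) (c : Γ →₀ ℝ) :
    Finsupp.linearCombination ℝ w (leftTranslate γ c - totalMass Γ c • Finsupp.single γ 1) =
      Finsupp.linearCombination ℝ (fun g => w (γ * g) - w γ) c := by
  have : Finsupp.linearCombination ℝ w ∘ₗ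
      (leftTranslate γ - (totalMass Γ).smulRight (Finsupp.single γ 1)) =
      Finsupp.linearCombination ℝ (fun g => w (γ * g) - w γ) := by
    ext g
    simp [leftTranslate_single, totalMass_single]
  simpa using LinearMap.congr_fun this c

section Field

variable {Γ H : Type u} [NormedAddCommGroup H] [InnerProductSpace ℝ H]
  {b : Γ → H} {μ : Measure (Γ → ℝ)}

theorem map_sub_of_gaussian (hμ : ∀ c : Γ →₀ ℝ, μ.map (fun x => Finsupp.linearCombination ℝ x c) =
      gaussianReal 0 (‖Finsupp.linearCombination ℝ b c‖ ^ 2).toNNReal) (g h : Γ) :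
    μ.map (fun x => x g - x h) = gaussianReal 0 (‖b g - b h‖ ^ 2).toNNReal := by
  have := hμ (Finsupp.single g 1 - Finsupp.single h 1)
  simpa only [map_sub, Finsupp.linearCombination_single, one_smul] using this

variable [Group Γ]

/-- The law depends only on the norms of combinations of `b`. Shifting replaces `b` by `π γ⁻¹ ∘ b`,
by the cocycle identity, and `π γ⁻¹` preserves these norms. -/
theorem map_shiftField_of_gaussian [IsProbabilityMeasure μ]
    (hμ : ∀ c : Γ →₀ ℝ, μ.map (fun x => Finsupp.linearCombination ℝ x c) =
      gaussianReal 0 (‖Finsupp.linearCombination ℝ b c‖ ^ 2).toNNReal)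
    (π : Γ → H →ₗᵢ[ℝ] H) (hb : ∀ g h, b (g * h) = π g (b h) + b g) (γ : Γ) :
    μ.map (shiftField γ) = μ := by
  have : IsProbabilityMeasure (μ.map (shiftField γ)) :=
    Measure.isProbabilityMeasure_map (measurable_shiftField γ).aemeasurable
  refine Measure.ext_of_map_linearCombination fun c => ?_
  rw [Measure.map_map (measurable_linearCombination_left c) (measurable_shiftField γ)]
  let c' : Γ →₀ ℝ := leftTranslate γ⁻¹ c - totalMass Γ c • Finsupp.single γ⁻¹ 1
  have h1 : (fun x => Finsupp.linearCombination ℝ x c) ∘ shiftField γ =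
      fun x : Γ → ℝ => Finsupp.linearCombination ℝ x c' :=
    funext fun x => (linearCombination_leftTranslate_sub γ⁻¹ x c).symm
  have h2 : ‖Finsupp.linearCombination ℝ b c'‖ = ‖Finsupp.linearCombination ℝ b c‖ := by
    have h3 : (fun g => b (γ⁻¹ * g) - b γ⁻¹) = π γ⁻¹ ∘ b := by
      funext g
      simp [hb]
    rw [linearCombination_leftTranslate_sub, h3, ← (π γ⁻¹).norm_map (Finsupp.linearCombination ℝ b c)]
    congr 1
    simp [Finsupp.linearCombination_apply, Finsupp.sum]
  rw [h1, hμ, hμ, h2]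

theorem floorPercolation_one_mem_ge [IsProbabilityMeasure μ] (S : Finset Γ)
    (hμ : ∀ c : Γ →₀ ℝ, μ.map (fun x => Finsupp.linearCombination ℝ x c) =
      gaussianReal 0 (‖Finsupp.linearCombination ℝ b c‖ ^ 2).toNNReal) :
    1 - (∑ s ∈ S, ‖b s - b 1‖) * (∫⁻ y, ENNReal.ofReal |y| ∂gaussianReal 0 1).toReal ≤
      (floorPercolation S μ).real {ω : Set Γ | (1 : Γ) ∈ ω} := by
  have : IsProbabilityMeasure (floorPercolation S μ) :=
    Measure.isProbabilityMeasure_map (measurable_floorSites S).aemeasurable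
  have hm : MeasurableSet {ω : Set Γ | (1 : Γ) ∈ ω} :=
    measurableSet_setOfPred.2 (measurable_set_mem 1)
  set C := ∫⁻ y, ENNReal.ofReal |y| ∂gaussianReal 0 1 with hC
  have h1 : ∀ s, ∫⁻ x, ENNReal.ofReal |x s - x 1| ∂μ = ENNReal.ofReal ‖b s - b 1‖ * C := fun s => by
    rw [← lintegral_map (f := fun y : ℝ => ENNReal.ofReal |y|)
      (g := fun x : Γ → ℝ => x s - x 1) (by fun_prop) (by fun_prop), map_sub_of_gaussian hμ,
      lintegral_abs_gaussianReal, abs_of_nonneg (norm_nonneg _)]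
  have h2 := floorPercolation_one_notMem_le S μ
  simp_rw [h1] at h2
  rw [← Finset.sum_mul, ← ENNReal.ofReal_sum_of_nonneg fun s _ => norm_nonneg _] at h2
  have h3 := ENNReal.toReal_mono (ENNReal.mul_ne_top ENNReal.ofReal_ne_top
    lintegral_abs_gaussianReal_ne_top) h2
  rw [ENNReal.toReal_mul, ENNReal.toReal_ofReal (Finset.sum_nonneg fun s _ => norm_nonneg _),
    ← measureReal_def, probReal_compl_eq_one_sub hm] at h3
  linarith

theorem floorPercolation_vanishesAtInfinity [Countable Γ] [IsProbabilityMeasure μ] (S : Finset Γ)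
    (hS : Subgroup.closure (S : Set Γ) = ⊤)
    (hμ : ∀ c : Γ →₀ ℝ, μ.map (fun x => Finsupp.linearCombination ℝ x c) =
      gaussianReal 0 (‖Finsupp.linearCombination ℝ b c‖ ^ 2).toNNReal)
    (hb : ∀ g h, ‖b g - b h‖ = ‖b (g⁻¹ * h)‖) (hproper : ∀ M : ℝ, {g : Γ | ‖b g‖ ≤ M}.Finite) :
    VanishesAtInfinity (SimpleGraph.mulCayley (S : Set Γ))
      (twoPointFunction (SimpleGraph.mulCayley (S : Set Γ)) (floorPercolation S μ)) := by
  intro ε hε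
  -- Outside this ball the increment has standard deviation above `2 / ε`, so `gaussianReal_Icc_le`
  -- with `a = 1` gives a probability below `ε`.
  refine ⟨(hproper (2 / ε)).toFinset.sup fun k => (SimpleGraph.mulCayley (S : Set Γ)).dist 1 k,
    fun g h hgh => ?_⟩
  have h1 : 2 / ε < ‖b g - b h‖ := by
    rw [hb]
    by_contra! hle
    have h2 := Finset.le_sup (f := fun k => (SimpleGraph.mulCayley (S : Set Γ)).dist 1 k)
      ((hproper (2 / ε)).mem_toFinset.2 hle)
    have h3 := SimpleGraph.mulCayley_dist_mul_left hS g 1 (g⁻¹ * h)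
    rw [mul_one, mul_inv_cancel_left] at h3
    exact absurd hgh (not_lt.2 (h3.trans_le h2))
  have hpos : 0 < ‖b g - b h‖ := (by positivity : 0 < 2 / ε).trans h1
  have hnn : 0 ≤ twoPointFunction (SimpleGraph.mulCayley (S : Set Γ)) (floorPercolation S μ) g h :=
    measureReal_nonneg
  rw [abs_of_nonneg hnn]
  refine (floorPercolation_twoPointFunction_le S μ g h).trans ?_
  have h4 : μ.real {x : Γ → ℝ | x g - x h ∈ Set.Icc (-1 : ℝ) 1} =
      (μ.map fun x => x g - x h).real (Set.Icc (-1) 1) := by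
    rw [map_measureReal_apply (by fun_prop) measurableSet_Icc]
    rfl
  rw [h4, map_sub_of_gaussian hμ, measureReal_def]
  refine (ENNReal.toReal_mono ENNReal.ofReal_ne_top (gaussianReal_Icc_le hpos 1)).trans ?_
  rw [ENNReal.toReal_ofReal (by positivity), mul_one, div_le_iff₀ hpos]
  rw [div_lt_iff₀ hε] at h1
  linarith

end Field

/-! ### From the Haagerup property to percolations, and the equivalence -/

theorem exists_percolation_of_hasHaagerupProperty {Γ : Type u} [Group Γ] (S : Finset Γ)
    (hS : Subgroup.closure (S : Set Γ) = ⊤) (hΓ : HasHaagerupProperty Γ) {α : ℝ} (hα : α < 1) :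
    ∃ P : Measure (Set Γ), IsInvariantSitePercolation P ∧
      α < P.real {ω : Set Γ | (1 : Γ) ∈ ω} ∧
      VanishesAtInfinity (SimpleGraph.mulCayley (S : Set Γ))
        (twoPointFunction (SimpleGraph.mulCayley (S : Set Γ)) P) := by
  have : Countable Γ := countable_of_closure_eq_top S hS
  obtain ⟨H, _, _, _, ρ, hρ⟩ := hΓ
  let π : Γ → H →ₗᵢ[ℝ] H := fun g => (ρ g).linearIsometryEquiv.toLinearIsometry
  have hcocycle : ∀ g h, ρ (g * h) 0 = π g (ρ h 0) + ρ g 0 := fun g h => by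
    have := (ρ g).map_vadd 0 (ρ h 0)
    simp only [vadd_eq_add, add_zero] at this
    rw [map_mul]
    exact this
  have hproper : ∀ M : ℝ, {g : Γ | ‖ρ g 0‖ ≤ M}.Finite := fun M => by
    refine (hρ (Metric.closedBall 0 M) Metric.isBounded_closedBall).subset fun g hg => ?_
    refine ⟨ρ g 0, ⟨0, ?_, rfl⟩, by simpa using hg⟩
    simpa using (norm_nonneg _).trans hg
  set C := (∫⁻ y, ENNReal.ofReal |y| ∂gaussianReal 0 1).toReal
  have hC : 0 ≤ C := ENNReal.toReal_nonneg
  set K := (∑ s ∈ S, ‖ρ s 0‖) * C with hK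
  have hK0 : 0 ≤ K := mul_nonneg (Finset.sum_nonneg fun _ _ => norm_nonneg _) hC
  -- Scaling the cocycle by `t` bounds the probability that the identity is closed by `t * K`. The
  -- witness divides by `K + 1` because `K` may be zero.
  obtain ⟨t, ht, htK⟩ : ∃ t : ℝ, 0 < t ∧ t * K < 1 - α := by
    refine ⟨(1 - α) / (K + 1), div_pos (by linarith) (by linarith), ?_⟩
    rw [div_mul_eq_mul_div, div_lt_iff₀ (by linarith)]
    nlinarith
  let b : Γ → H := fun g => t • ρ g 0
  have hb : ∀ g h, b (g * h) = π g (b h) + b g := fun g h => by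
    simp only [b, hcocycle, smul_add, map_smul]
  have hb1 : b 1 = 0 := by simp [b]
  have hnorm : ∀ g, ‖b g‖ = t * ‖ρ g 0‖ := fun g => by
    simp only [b, norm_smul, Real.norm_eq_abs, abs_of_pos ht]
  obtain ⟨μ, hμp, hμ⟩ := exists_gaussian_process b
  refine ⟨floorPercolation S μ,
    floorPercolation_isInvariant S μ (map_shiftField_of_gaussian hμ π hb), ?_,
    floorPercolation_vanishesAtInfinity S hS hμ (fun g h => ?_) fun M => ?_⟩
  · refine lt_of_lt_of_le ?_ (floorPercolation_one_mem_ge S hμ)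
    simp_rw [hb1, sub_zero, hnorm, ← Finset.mul_sum]
    rw [mul_assoc, ← hK]
    linarith
  · have h1 := hb g (g⁻¹ * h)
    rw [mul_inv_cancel_left] at h1
    rw [h1, norm_sub_rev, add_sub_cancel_right, (π g).norm_map]
  · refine (hproper (M / t)).subset fun g hg => ?_
    change ‖ρ g 0‖ ≤ M / t
    rw [le_div_iff₀ ht, mul_comm, ← hnorm]
    exact hg

theorem mainTheorem10 {Γ : Type u} [Group Γ] (S : Finset Γ)
    (hS : Subgroup.closure (S : Set Γ) = ⊤) :
    HasHaagerupProperty Γ ↔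
      ∀ α : ℝ, α < 1 → ∃ P : Measure (Set Γ), IsInvariantSitePercolation P ∧
        α < P.real {ω : Set Γ | (1 : Γ) ∈ ω} ∧
        VanishesAtInfinity (SimpleGraph.mulCayley (S : Set Γ))
          (twoPointFunction (SimpleGraph.mulCayley (S : Set Γ)) P) :=
  ⟨fun hΓ _ hα => exists_percolation_of_hasHaagerupProperty S hS hΓ hα,
    hasHaagerupProperty_of_percolations S hS⟩
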